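/- Let $M_1,\dots,M_m$ ($m\ge 1$) be smooth manifolds without boundary (Hausdorff, second countable, finite-dimensional, of possibly different dimensions), let $\mu_i$ be a compactly supported Borel probability measure on $M_i$ for $i=1,\dots,m$, and let $c:M_1\times\dots\times M_m\to\mathbb R$ be continuous and (locally) semi-concave, i.e. around every point, in a product of local coordinate charts of the $M_i$, $c$ is the sum of a concave function and a constant multiple of the squared Euclidean norm. A set $S\subseteq M_1\times\dots\times M_m$ is called a *$c$-splitting set* if there are Borel functions $u_i:M_i\to\mathbb R$ with $\sum_{i=1}^m u_i(x_i)\le c(x_1,\dots,x_m)$ for all $(x_1,\dots,x_m)$, with equality whenever $(x_1,\dots,x_m)\in S$. Assume that $c$ is *twisted on $c$-splitting sets*: for every $x_1\in M_1$ and every $c$-splitting set $S\subseteq\{x_1\}\times M_2\times\dots\times M_m$, the map $(x_2,\dots,x_m)\mapsto D_{x_1}c(x_1,x_2,\dots,x_m)$ is injective on the subset of $S$ where $c$ is differentiable with respect to $x_1$. Assume also that $\mu_1$ is absolutely continuous in local coordinates, i.e. in every coordinate chart of $M_1$ the set of points whose coordinates lie in a given Lebesgue-null set is $\mu_1$-null.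 Consider the problem of minimizing $\int c\,d\gamma$ over all Borel probability measures $\gamma$ on $M_1\times\dots\times M_m$ with marginals $\mu_1,\dots,\mu_m$. Then every minimizer $\gamma$ induces a Monge solution: there is a Borel map $T:M_1\to M_2\times\dots\times M_m$ such that $\gamma$ is concentrated on the graph $\{(x_1,T(x_1)) : x_1\in M_1\}$, and $\gamma=(\mathrm{Id},T)_\#\mu_1$. Moreover, there is exactly one minimizer. -/

import Mathlib

open Set Filter Topology MeasureTheory
open scoped Manifold ContDiff

section MultiMarginal

variable {n : ℕ} {d : Fin (n + 1) → ℕ} {M : Fin (n + 1) → Type*}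

/-- A set `S` in the product is `c`-splitting: there are real-valued Borel functions `u i` on the
factors whose sum is everywhere at most `c`, with equality on `S`. -/
def IsSplittingSet [∀ i, MeasurableSpace (M i)] (c : (∀ i, M i) → ℝ) (S : Set (∀ i, M i)) : Prop :=
  ∃ u : ∀ i, M i → ℝ, (∀ i, Measurable (u i)) ∧
    (∀ x, ∑ i, u i (x i) ≤ c x) ∧ ∀ x ∈ S, ∑ i, u i (x i) = c x

/-- A function on a product of manifolds is (locally) semi-concave: around each point `x`, in the
product of the coordinate charts at the `x i`, it is a concave function plus a multiple of the
squared Euclidean norm. Transition maps are smooth, so the choice of the charts is immaterial. -/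
def IsSemiconcave [∀ i, TopologicalSpace (M i)]
    [∀ i, ChartedSpace (EuclideanSpace ℝ (Fin (d i))) (M i)] (c : (∀ i, M i) → ℝ) : Prop :=
  ∀ x : ∀ i, M i, ∃ C : ℝ,
    ∃ U ∈ 𝓝 (fun i => chartAt (EuclideanSpace ℝ (Fin (d i))) (x i) (x i)),
      (∀ v ∈ U, ∀ i, v i ∈ (chartAt (EuclideanSpace ℝ (Fin (d i))) (x i)).target) ∧
      ConcaveOn ℝ U (fun v : ∀ i, EuclideanSpace ℝ (Fin (d i)) =>
        c (fun i => (chartAt (EuclideanSpace ℝ (Fin (d i))) (x i)).symm (v i))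
          - C * ∑ i, ‖v i‖ ^ 2)

/-- At the point `(p, x₂, …, x_m)`, the cost is differentiable in its first variable.
The first coordinate of `x` is disregarded. -/
def FirstDifferentiableAt [∀ i, TopologicalSpace (M i)]
    [∀ i, ChartedSpace (EuclideanSpace ℝ (Fin (d i))) (M i)]
    (c : (∀ i, M i) → ℝ) (p : M 0) (x : ∀ i, M i) : Prop :=
  MDifferentiableAt (𝓡 (d 0)) 𝓘(ℝ, ℝ) (fun y : M 0 => c (Function.update x 0 y)) p

/-- The differential of the cost in its first variable at the point `(p, x₂, …, x_m)`, a
cotangent vector at `p`. -/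
noncomputable def firstDifferential [∀ i, TopologicalSpace (M i)]
    [∀ i, ChartedSpace (EuclideanSpace ℝ (Fin (d i))) (M i)]
    (c : (∀ i, M i) → ℝ) (p : M 0) (x : ∀ i, M i) : TangentSpace (𝓡 (d 0)) p →L[ℝ] ℝ :=
  mfderiv (𝓡 (d 0)) 𝓘(ℝ, ℝ) (fun y : M 0 => c (Function.update x 0 y)) p

/-- Twist on `c`-splitting sets: over each point `p` of the first manifold, the differential in the
first variable is injective on the part of any `c`-splitting set where it exists. -/
def IsTwistedOnSplittingSets [∀ i, TopologicalSpace (M i)] [∀ i, MeasurableSpace (M i)]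
    [∀ i, ChartedSpace (EuclideanSpace ℝ (Fin (d i))) (M i)] (c : (∀ i, M i) → ℝ) : Prop :=
  ∀ (p : M 0) (S : Set (∀ i, M i)), (∀ x ∈ S, x 0 = p) → IsSplittingSet c S →
    InjOn (firstDifferential (d := d) c p) {x ∈ S | FirstDifferentiableAt (d := d) c p x}

/-- A measure on a manifold is absolutely continuous in local coordinates: in each chart, the
points whose coordinates lie in a Lebesgue-null set form a null set. -/
def IsAbsolutelyContinuousInCharts (k : ℕ) {X : Type*} [TopologicalSpace X] [MeasurableSpace X]
    [ChartedSpace (EuclideanSpace ℝ (Fin k)) X] (μ : Measure X) : Prop :=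
  ∀ (p : X) (N : Set (EuclideanSpace ℝ (Fin k))), volume N = 0 →
    μ ((chartAt (EuclideanSpace ℝ (Fin k)) p).source ∩
      chartAt (EuclideanSpace ℝ (Fin k)) p ⁻¹' N) = 0

/-- Transport plans: probability measures on the product with marginals `μ i`. -/
def IsTransportPlan [∀ i, MeasurableSpace (M i)] (μ : ∀ i, Measure (M i))
    (γ : Measure (∀ i, M i)) : Prop :=
  IsProbabilityMeasure γ ∧ ∀ i, γ.map (fun x => x i) = μ i

/-- Optimal plans for the multi-marginal problem. (For compactly supported marginals and a
continuous cost, the cost is integrable for every plan.) -/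
def IsOptimalPlan [∀ i, MeasurableSpace (M i)] (c : (∀ i, M i) → ℝ) (μ : ∀ i, Measure (M i))
    (γ : Measure (∀ i, M i)) : Prop :=
  IsTransportPlan μ γ ∧ ∀ γ', IsTransportPlan μ γ' → ∫ x, c x ∂γ ≤ ∫ x, c x ∂γ'

/-- `γ` induces a Monge solution: it is concentrated on the graph of a Borel map `T` from the first
factor to the product of the others; equivalently it is the image of its first marginal
under `x ↦ (x, T x)`, which is recorded too. -/
def InducesMongeSolution [∀ i, MeasurableSpace (M i)] (μ : ∀ i, Measure (M i))
    (γ : Measure (∀ i, M i)) : Prop :=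
  ∃ T : M 0 → ∀ j : Fin n, M j.succ, Measurable T ∧
    (∀ᵐ x ∂γ, (fun j : Fin n => x j.succ) = T (x 0)) ∧
    γ = (μ 0).map (fun x => (Fin.cons x (T x) : ∀ i, M i))

end MultiMarginal

/-! Linear programming duality confines all minimizers to one contact set, and the twist condition
turns that set into a graph. Kantorovich duality on the compact supports yields a minimizer and
continuous potentials `u i` with sum at most `c`. The gap `c - ∑ u i` is nonnegative and has
integral zero against every optimal plan, so all of them live on the compact set `S` where it
vanishes. Extended to Borel functions on the whole factors, the potentials show that `S` is a
splitting set. Let `w` be the infimum over the other supports of `c` minus the other potentials.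
Semi-concavity makes `w` locally Lipschitz, hence differentiable `μ 0`-almost everywhere by
Rademacher and absolute continuity. Over such a point `p`, each point of `S` is one where `w` plus a
constant touches `c` from below in the first variable. A semi-concave function touched from below by
a differentiable one is differentiable with the same derivative
(`IsSemiconcave.hasMFDerivAt_of_touching`). All points of `S` over `p` thus share the first
differential `Dw(p)`, and the twist leaves at most one. The resulting map `T` depends on `S` only,
so every optimal plan is the image of `μ 0` under the same map; this gives uniqueness. Duality
itself is Hahn–Banach plus Riesz (`exists_plan_integral_lt`); dual attainment comes from conjugating
and normalizing potentials into an Arzelà–Ascoli compact set (`exists_plan_integral_eq`). -/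

/-! ### Kantorovich duality on compact spaces via Hahn–Banach and Riesz. -/

section CompactDuality

variable {ι : Type*} [Fintype ι] {X : ι → Type*} [∀ i, TopologicalSpace (X i)]

/-- The function `x ↦ ∑ i, u i (x i)` on the product. -/
def ContinuousMap.piSum (u : ∀ i, C(X i, ℝ)) : C(∀ i, X i, ℝ) :=
  ⟨fun x => ∑ i, u i (x i), by fun_prop⟩

@[simp]
lemma ContinuousMap.piSum_apply (u : ∀ i, C(X i, ℝ)) (x : ∀ i, X i) :
    ContinuousMap.piSum u x = ∑ i, u i (x i) := rfl

/-- A positive linear functional on the continuous functions on a compact space is the integral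
against a finite measure. -/
lemma exists_finiteMeasure_of_positive_functional {Y : Type*} [TopologicalSpace Y] [CompactSpace Y]
    [T2Space Y] [MeasurableSpace Y] [BorelSpace Y] (L : C(Y, ℝ) →ₗ[ℝ] ℝ)
    (hL : ∀ f, (∀ y, 0 ≤ f y) → 0 ≤ L f) :
    ∃ γ : Measure Y, IsFiniteMeasure γ ∧ ∀ f : C(Y, ℝ), ∫ y, f y ∂γ = L f := by
  let e : CompactlySupportedContinuousMap Y ℝ →ₗ[ℝ] C(Y, ℝ) :=
    { toFun := fun f => f.toContinuousMap
      map_add' := fun f g => rfl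
      map_smul' := fun a f => rfl }
  let Λ : CompactlySupportedContinuousMap Y ℝ →ₚ[ℝ] ℝ :=
    PositiveLinearMap.mk₀ (L.comp e) (fun f hf => hL _ fun y => hf y)
  have hreg : (RealRMK.rieszMeasure Λ).Regular := by infer_instance
  refine ⟨RealRMK.rieszMeasure Λ, ⟨?_⟩, fun f => ?_⟩
  · exact isCompact_univ.measure_lt_top
  · exact RealRMK.integral_rieszMeasure Λ (CompactlySupportedContinuousMap.continuousMapEquiv f)

variable [∀ i, MeasurableSpace (X i)]

/-- The cost of the cheapest family of continuous potentials dominating `f`. -/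
noncomputable def dualCost (ν : ∀ i, Measure (X i)) (f : C(∀ i, X i, ℝ)) : ℝ :=
  sInf {r | ∃ u : ∀ i, C(X i, ℝ), (∀ x, f x ≤ ContinuousMap.piSum u x) ∧
    r = ∑ i, ∫ y, u i y ∂(ν i)}

variable [∀ i, CompactSpace (X i)]

lemma exists_lt_dualCost_add [Nonempty ι] (ν : ∀ i, Measure (X i))
    (f : C(∀ i, X i, ℝ)) {ε : ℝ} (hε : 0 < ε) :
    ∃ u : ∀ i, C(X i, ℝ), (∀ x, f x ≤ ContinuousMap.piSum u x) ∧
      ∑ i, ∫ y, u i y ∂(ν i) < dualCost ν f + ε := by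
  classical
  obtain ⟨i₀⟩ := ‹Nonempty ι›
  have hne : {r | ∃ u : ∀ i, C(X i, ℝ), (∀ x, f x ≤ ContinuousMap.piSum u x) ∧
    r = ∑ i, ∫ y, u i y ∂(ν i)}.Nonempty := by
    refine ⟨_, fun i => ContinuousMap.const _ (if i = i₀ then ‖f‖ else 0), fun x => ?_, rfl⟩
    simpa using (le_abs_self _).trans (f.norm_coe_le_norm x)
  obtain ⟨r, ⟨u, hu, rfl⟩, hr⟩ := exists_lt_of_csInf_lt hne (lt_add_of_pos_right _ hε)
  exact ⟨u, hu, hr⟩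

variable [∀ i, SecondCountableTopology (X i)] [∀ i, BorelSpace (X i)]

lemma integrable_of_continuous_compactSpace {Y : Type*} [TopologicalSpace Y] [CompactSpace Y]
    [SecondCountableTopology Y] [MeasurableSpace Y] [BorelSpace Y] (μ : Measure Y)
    [IsFiniteMeasure μ] (f : C(Y, ℝ)) : Integrable f μ :=
  Integrable.of_bound f.continuous.aestronglyMeasurable ‖f‖
    (Eventually.of_forall fun x => f.norm_coe_le_norm x)

lemma integral_piSum {ν : ∀ i, Measure (X i)} [∀ i, IsProbabilityMeasure (ν i)]
    {γ : Measure (∀ i, X i)} (hγ : ∀ i, γ.map (fun x => x i) = ν i) (u : ∀ i, C(X i, ℝ)) :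
    ∫ x, ContinuousMap.piSum u x ∂γ = ∑ i, ∫ y, u i y ∂(ν i) := by
  simp only [ContinuousMap.piSum_apply]
  have h1 : ∀ i, Integrable (fun x : ∀ i, X i => u i (x i)) γ := by
    intro i
    have := integrable_of_continuous_compactSpace (ν i) (u i)
    rw [← hγ i] at this
    exact this.comp_measurable (measurable_pi_apply i)
  rw [integral_finsetSum _ fun i _ => h1 i]
  refine Finset.sum_congr rfl fun i _ => ?_
  rw [← hγ i, integral_map (measurable_pi_apply i).aemeasurable
    (u i).continuous.aestronglyMeasurable]

variable (ν : ∀ i, Measure (X i)) [∀ i, IsProbabilityMeasure (ν i)]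

lemma dualCost_le {f : C(∀ i, X i, ℝ)} {u : ∀ i, C(X i, ℝ)}
    (h : ∀ x, f x ≤ ContinuousMap.piSum u x) : dualCost ν f ≤ ∑ i, ∫ y, u i y ∂(ν i) := by
  -- The product measure is a plan, so the integral of `f` against it bounds all admissible values
  -- from below.
  refine csInf_le ⟨∫ x, f x ∂(Measure.pi ν), ?_⟩ ⟨u, h, rfl⟩
  rintro r ⟨v, hv, rfl⟩
  rw [← integral_piSum (γ := Measure.pi ν) (fun i => (measurePreserving_eval ν i).map_eq)]
  exact integral_mono (integrable_of_continuous_compactSpace _ _)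
    (integrable_of_continuous_compactSpace _ _) hv

lemma dualCost_add_le [Nonempty ι] (f g : C(∀ i, X i, ℝ)) :
    dualCost ν (f + g) ≤ dualCost ν f + dualCost ν g := by
  refine le_of_forall_pos_le_add fun ε hε => ?_
  obtain ⟨u, hu, hu'⟩ := exists_lt_dualCost_add ν f (half_pos hε)
  obtain ⟨v, hv, hv'⟩ := exists_lt_dualCost_add ν g (half_pos hε)
  have := dualCost_le ν (f := f + g) (u := u + v) fun x => by
    have := add_le_add (hu x) (hv x)
    simpa [Finset.sum_add_distrib] using this
  have h2 : ∑ i, ∫ y, (u + v) i y ∂(ν i) = ∑ i, ∫ y, u i y ∂(ν i) + ∑ i, ∫ y, v i y ∂(ν i) := by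
    rw [← Finset.sum_add_distrib]
    refine Finset.sum_congr rfl fun i _ => ?_
    exact integral_add (integrable_of_continuous_compactSpace _ (u i))
      (integrable_of_continuous_compactSpace _ (v i))
  linarith

lemma dualCost_smul_le [Nonempty ι] {t : ℝ} (ht : 0 < t) (f : C(∀ i, X i, ℝ)) :
    dualCost ν (t • f) ≤ t * dualCost ν f := by
  refine le_of_forall_pos_le_add fun ε hε => ?_
  obtain ⟨u, hu, hu'⟩ := exists_lt_dualCost_add ν f (div_pos hε ht)
  have h1 := dualCost_le ν (f := t • f) (u := t • u) fun x => by
    have := mul_le_mul_of_nonneg_left (hu x) ht.le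
    simpa [Finset.mul_sum] using this
  have h2 : ∑ i, ∫ y, (t • u) i y ∂(ν i) = t * ∑ i, ∫ y, u i y ∂(ν i) := by
    rw [Finset.mul_sum]
    refine Finset.sum_congr rfl fun i _ => ?_
    exact integral_const_mul t _
  have h3 := mul_lt_mul_of_pos_left hu' ht
  rw [mul_add, mul_div_cancel₀ _ ht.ne'] at h3
  linarith

lemma dualCost_smul [Nonempty ι] {t : ℝ} (ht : 0 < t) (f : C(∀ i, X i, ℝ)) :
    dualCost ν (t • f) = t * dualCost ν f := by
  refine le_antisymm (dualCost_smul_le ν ht f) ?_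
  have := dualCost_smul_le ν (inv_pos.2 ht) (t • f)
  rw [smul_smul, inv_mul_cancel₀ ht.ne', one_smul] at this
  have h := mul_le_mul_of_nonneg_left this ht.le
  rwa [mul_inv_cancel_left₀ ht.ne'] at h

/-- A sublinear functional dominates a linear functional which agrees with it at a given point. -/
lemma exists_linearMap_le_sublinear {E : Type*} [AddCommGroup E] [Module ℝ E] (N : E → ℝ)
    (N_hom : ∀ c : ℝ, 0 < c → ∀ x, N (c • x) = c * N x) (N_add : ∀ x y, N (x + y) ≤ N x + N y)
    (a : E) : ∃ L : E →ₗ[ℝ] ℝ, L a = N a ∧ ∀ x, L x ≤ N x := by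
  have N_0 : N 0 = 0 := by
    have := N_hom 2 (by norm_num) 0
    rw [smul_zero] at this
    linarith
  have H : ∀ t : ℝ, t • a = 0 → (RingHom.id ℝ t) • N a = 0 := by
    intro t ht
    rcases smul_eq_zero.1 ht with h | h
    · simp [h]
    · simp [h, N_0]
  obtain ⟨L, hL, hL'⟩ := exists_extension_of_le_sublinear
    (LinearPMap.mkSpanSingleton' a (N a) H) N N_hom N_add (by
      rintro ⟨x, hx⟩
      obtain ⟨t, rfl⟩ := Submodule.mem_span_singleton.1 hx
      rw [LinearPMap.mkSpanSingleton'_apply]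
      simp only [RingHom.id_apply, smul_eq_mul]
      rcases lt_trichotomy t 0 with ht | rfl | ht
      -- For negative `t`, `0 = N 0 ≤ N (t • a) - t * N a` by subadditivity.
      · have h1 := N_add (t • a) ((-t) • a)
        rw [← add_smul, add_neg_cancel, zero_smul, N_0, N_hom (-t) (by linarith)] at h1
        linarith
      · simp [N_0]
      · rw [N_hom t ht])
  refine ⟨L, ?_, hL'⟩
  have h1 : (1 : ℝ) • a ∈ (LinearPMap.mkSpanSingleton' a (N a) H).domain :=
    Submodule.mem_span_singleton.2 ⟨1, rfl⟩
  have h2 := hL ⟨_, h1⟩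
  rw [LinearPMap.mkSpanSingleton'_apply] at h2
  simpa using h2

/-- **Kantorovich duality** without attainment of the dual problem: some plan costs no more than the
supremum of the dual problem. -/
theorem exists_plan_integral_lt [∀ i, T2Space (X i)] [Nonempty ι] (c : C(∀ i, X i, ℝ)) :
    ∃ γ : Measure (∀ i, X i), IsProbabilityMeasure γ ∧ (∀ i, γ.map (fun x => x i) = ν i) ∧
      ∀ ε > 0, ∃ u : ∀ i, C(X i, ℝ), (∀ x, ∑ i, u i (x i) ≤ c x) ∧
        ∫ x, c x ∂γ - ε < ∑ i, ∫ y, u i y ∂(ν i) := by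
  classical
  -- The value at `-c` is minus the dual supremum, so `L c` is that supremum. Domination by
  -- `dualCost` forces positivity and the marginals of `L`.
  obtain ⟨L, hLc, hL⟩ := exists_linearMap_le_sublinear (dualCost ν)
    (fun t ht f => dualCost_smul ν ht f) (dualCost_add_le ν) (-c)
  have hLu : ∀ u : ∀ i, C(X i, ℝ), L (ContinuousMap.piSum u) = ∑ i, ∫ y, u i y ∂(ν i) := by
    intro u
    -- The domination, applied to both `u` and `-u`, pins the value of `L` on sums.
    refine le_antisymm ((hL _).trans (dualCost_le ν fun x => le_rfl)) ?_
    have h := (hL (-ContinuousMap.piSum u)).trans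
      (dualCost_le ν (u := -u) fun x => by simp)
    simp only [map_neg, Pi.neg_apply, ContinuousMap.neg_apply, integral_neg,
      Finset.sum_neg_distrib] at h
    linarith
  obtain ⟨γ, hγ, hγL⟩ := exists_finiteMeasure_of_positive_functional L (fun f hf => by
    have h := (hL (-f)).trans (dualCost_le ν (u := 0) fun x => by simpa using hf x)
    simpa using h)
  have hsingle : ∀ i (v : C(X i, ℝ)), ∫ x, v (x i) ∂γ = ∫ y, v y ∂(ν i) := by
    intro i v
    have h1 := hLu (Pi.single i v)
    have h2 : ∀ x : ∀ i, X i, ContinuousMap.piSum (Pi.single i v) x = v (x i) := by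
      intro x
      rw [ContinuousMap.piSum_apply, Finset.sum_eq_single i]
      · simp
      · intro j _ hj
        simp [Pi.single_eq_of_ne hj]
      · simp
    rw [← hγL, integral_congr_ae (Eventually.of_forall h2), Finset.sum_eq_single i] at h1
    · simpa using h1
    · intro j _ hj
      simp [Pi.single_eq_of_ne hj]
    · simp
  have hmarg : ∀ i, γ.map (fun x => x i) = ν i := by
    intro i
    refine ext_of_forall_integral_eq_of_IsFiniteMeasure fun f => ?_
    rw [integral_map (measurable_pi_apply i).aemeasurable
      f.continuous.aestronglyMeasurable]
    exact hsingle i f.toContinuousMap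
  refine ⟨γ, ?_, hmarg, fun ε hε => ?_⟩
  · obtain ⟨i₀⟩ := ‹Nonempty ι›
    have h : IsProbabilityMeasure (γ.map fun x => x i₀) := by rw [hmarg]; infer_instance
    exact (Measure.isProbabilityMeasure_map_iff (measurable_pi_apply i₀).aemeasurable).1 h
  · obtain ⟨u, hu, hu'⟩ := exists_lt_dualCost_add ν (-c) hε
    refine ⟨-u, fun x => ?_, ?_⟩
    · have := hu x
      simp only [ContinuousMap.neg_apply, ContinuousMap.piSum_apply] at this
      simp only [Pi.neg_apply, ContinuousMap.neg_apply, Finset.sum_neg_distrib]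
      linarith
    · simp only [Pi.neg_apply, ContinuousMap.neg_apply, integral_neg, Finset.sum_neg_distrib]
      rw [hγL, ← neg_neg c, map_neg, hLc]
      linarith

end CompactDuality

/-! ### Attainment in the dual problem. -/

section DualAttainment

/-- Bounded families of functions with a common modulus of continuity are compact. -/
lemma isCompact_setOf_modulus {Y E : Type*} [TopologicalSpace Y] [PseudoMetricSpace E]
    (Φ : Y → E) (hΦ : Continuous Φ) (B : ℝ) :
    IsCompact {v : C(Y, ℝ) | (∀ x y, |v x - v y| ≤ dist (Φ x) (Φ y)) ∧ ∀ x, |v x| ≤ B} := by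
  have hmod : ∀ v : Y → ℝ, (∀ x y, |v x - v y| ≤ dist (Φ x) (Φ y)) → Continuous v := by
    intro v hv
    refine continuous_iff_continuousAt.2 fun x => ?_
    refine tendsto_iff_dist_tendsto_zero.2 (squeeze_zero (fun _ => dist_nonneg) (fun y => hv y x) ?_)
    have : Tendsto (fun y => dist (Φ y) (Φ x)) (𝓝 x) (𝓝 (dist (Φ x) (Φ x))) :=
      (hΦ.dist continuous_const).tendsto x
    simpa using this
  refine ArzelaAscoli.isCompact_of_equicontinuous _ ?_ ?_
  -- Compactness for pointwise convergence: a closed subset of a product of intervals, in which the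
  -- modulus makes every function continuous.
  · have himg : ContinuousMap.toFun '' {v : C(Y, ℝ) |
        (∀ x y, |v x - v y| ≤ dist (Φ x) (Φ y)) ∧ ∀ x, |v x| ≤ B} =
        (Set.pi univ fun _ => Icc (-B) B) ∩ {v | ∀ x y, |v x - v y| ≤ dist (Φ x) (Φ y)} := by
      ext v
      constructor
      · rintro ⟨w, ⟨h1, h2⟩, rfl⟩
        exact ⟨fun x _ => abs_le.1 (h2 x), h1⟩
      · rintro ⟨h2, h1⟩
        exact ⟨⟨v, hmod v h1⟩, ⟨h1, fun x => abs_le.2 (h2 x (mem_univ x))⟩, rfl⟩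
    rw [himg]
    refine (isCompact_univ_pi fun _ => isCompact_Icc).inter_right ?_
    simp only [Set.ofPred_forall]
    refine isClosed_iInter fun x => isClosed_iInter fun y => isClosed_le ?_ continuous_const
    fun_prop
  · intro x
    refine Metric.equicontinuousAt_of_continuity_modulus (b := fun y => dist (Φ x) (Φ y)) ?_ _
      (Eventually.of_forall fun y v => v.2.1 x y)
    have : Tendsto (fun y => dist (Φ x) (Φ y)) (𝓝 x) (𝓝 (dist (Φ x) (Φ x))) :=
      (continuous_const.dist hΦ).tendsto x
    simpa using this

lemma sum_update_erase {ι : Type*} [Fintype ι] [DecidableEq ι] {X : ι → Type*}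
    (u : ∀ i, X i → ℝ) (z : ∀ i, X i) (i : ι) (x : X i) :
    ∑ j, u j (Function.update z i x j) = u i x + ∑ j ∈ Finset.univ.erase i, u j (z j) := by
  rw [← Finset.add_sum_erase _ _ (Finset.mem_univ i), Function.update_self]
  congr 1
  refine Finset.sum_congr rfl fun j hj => ?_
  rw [Function.update_of_ne (Finset.ne_of_mem_erase hj)]

variable {ι : Type*} [DecidableEq ι] {X : ι → Type*} [∀ i, TopologicalSpace (X i)]

/-- The map `x ↦ c(·, x, ·)` freezing the `i`-th coordinate of a continuous function. -/
noncomputable def frozenCoordinate (c : C(∀ i, X i, ℝ)) (i : ι) : C(X i, C(∀ i, X i, ℝ)) :=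
  ContinuousMap.curry ⟨fun p : X i × (∀ i, X i) => c (Function.update p.2 i p.1), by fun_prop⟩

@[simp]
lemma frozenCoordinate_apply (c : C(∀ i, X i, ℝ)) (i : ι) (x : X i) (z : ∀ i, X i) :
    frozenCoordinate c i x z = c (Function.update z i x) := rfl

variable [∀ i, CompactSpace (X i)]

lemma dist_frozenCoordinate_le (c : C(∀ i, X i, ℝ)) (i : ι) (x y : X i) :
    dist (frozenCoordinate c i x) (frozenCoordinate c i y) ≤ 2 * ‖c‖ := by
  rw [ContinuousMap.dist_le (by positivity)]
  intro z
  have h1 := c.norm_coe_le_norm (Function.update z i x)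
  have h2 := c.norm_coe_le_norm (Function.update z i y)
  simp only [frozenCoordinate_apply, Real.dist_eq]
  rw [Real.norm_eq_abs, abs_le] at h1 h2
  exact abs_le.2 ⟨by linarith [h1.1, h2.2], by linarith [h1.2, h2.1]⟩

variable [Fintype ι]

/-- The `i`-th potential can be increased to have the modulus of continuity of the cost. -/
lemma exists_conjugate_potential [∀ i, Nonempty (X i)] (c : C(∀ i, X i, ℝ)) (u : ∀ i, C(X i, ℝ))
    (hu : ∀ x, ∑ i, u i (x i) ≤ c x) (i : ι) :
    ∃ v : C(X i, ℝ), (∀ x, u i x ≤ v x) ∧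
      (∀ x y, |v x - v y| ≤ dist (frozenCoordinate c i x) (frozenCoordinate c i y)) ∧
      (∀ x, ∑ j, Function.update u i v j (x j) ≤ c x) ∧
      ∀ (b : ℝ), (∀ z, ∀ x, b ≤ c (Function.update z i x) - ∑ j ∈ Finset.univ.erase i, u j (z j)) →
        ∀ x, b ≤ v x := by
  have hlow : ∀ x z, u i x ≤ c (Function.update z i x) - ∑ j ∈ Finset.univ.erase i, u j (z j) := by
    intro x z
    have := hu (Function.update z i x)
    rw [sum_update_erase (fun i => u i)] at this
    linarith
  -- The `c`-conjugate of the other potentials: the largest choice compatible with the constraint.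
  -- As an infimum of functions with a common modulus, it has that modulus.
  let v : X i → ℝ := fun x =>
    ⨅ z : ∀ i, X i, (c (Function.update z i x) - ∑ j ∈ Finset.univ.erase i, u j (z j))
  have hbdd : ∀ x, BddBelow (range fun z : ∀ i, X i =>
      (c (Function.update z i x) - ∑ j ∈ Finset.univ.erase i, u j (z j))) := by
    rintro x
    refine ⟨u i x, ?_⟩
    rintro _ ⟨z, rfl⟩
    exact hlow x z
  have hone : ∀ x y, v x - v y ≤ dist (frozenCoordinate c i x) (frozenCoordinate c i y) := by
    intro x y
    rw [sub_le_iff_le_add', ← sub_le_iff_le_add]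
    refine le_ciInf fun z => ?_
    have h1 := ciInf_le (hbdd x) z
    have h2 := (le_abs_self _).trans (ContinuousMap.dist_apply_le_dist
      (f := frozenCoordinate c i x) (g := frozenCoordinate c i y) z)
    simp only [frozenCoordinate_apply] at h2
    change v x ≤ _ at h1
    linarith
  have hmod : ∀ x y, |v x - v y| ≤ dist (frozenCoordinate c i x) (frozenCoordinate c i y) := by
    intro x y
    refine abs_sub_le_iff.2 ⟨hone x y, ?_⟩
    rw [dist_comm]
    exact hone y x
  have hcont : Continuous v := by
    refine continuous_iff_continuousAt.2 fun x => ?_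
    refine tendsto_iff_dist_tendsto_zero.2
      (squeeze_zero (fun _ => dist_nonneg) (fun y => hmod y x) ?_)
    have : Tendsto (fun y => dist (frozenCoordinate c i y) (frozenCoordinate c i x)) (𝓝 x)
        (𝓝 (dist (frozenCoordinate c i x) (frozenCoordinate c i x))) :=
      ((frozenCoordinate c i).continuous.dist continuous_const).tendsto x
    simpa using this
  refine ⟨⟨v, hcont⟩, fun x => le_ciInf (hlow x), hmod, fun x => ?_,
    fun b hb x => le_ciInf fun z => hb z x⟩
  rw [← Finset.add_sum_erase _ _ (Finset.mem_univ i), Function.update_self]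
  have h1 := ciInf_le (hbdd (x i)) x
  rw [Function.update_eq_self] at h1
  change v (x i) ≤ _ at h1
  have h2 : ∑ j ∈ Finset.univ.erase i, Function.update u i ⟨v, hcont⟩ j (x j) =
      ∑ j ∈ Finset.univ.erase i, u j (x j) := by
    refine Finset.sum_congr rfl fun j hj => ?_
    rw [Function.update_of_ne (Finset.ne_of_mem_erase hj)]
  rw [h2]
  simp only [ContinuousMap.coe_mk]
  linarith

/-- Conjugate one index at a time. The modulus depends on `c` alone and the other potentials stay
put, so later replacements do not spoil earlier ones. -/
lemma exists_equicontinuous_potentials [∀ i, Nonempty (X i)] (c : C(∀ i, X i, ℝ))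
    (u : ∀ i, C(X i, ℝ)) (hu : ∀ x, ∑ i, u i (x i) ≤ c x) (s : Finset ι) :
    ∃ v : ∀ i, C(X i, ℝ), (∀ i x, u i x ≤ v i x) ∧ (∀ x, ∑ i, v i (x i) ≤ c x) ∧
      ∀ i ∈ s, ∀ x y, |v i x - v i y| ≤ dist (frozenCoordinate c i x) (frozenCoordinate c i y) := by
  induction s using Finset.induction_on with
  | empty => exact ⟨u, fun _ _ => le_rfl, hu, by simp⟩
  | insert i s hi ih =>
    obtain ⟨v, huv, hv, hvs⟩ := ih
    obtain ⟨w, hvw, hw, hsum, -⟩ := exists_conjugate_potential c v hv i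
    refine ⟨Function.update v i w, fun j x => ?_, hsum, fun j hj => ?_⟩
    · by_cases h : j = i
      · subst h
        simpa using (huv j x).trans (hvw x)
      · simpa [Function.update_of_ne h] using huv j x
    · by_cases h : j = i
      · subst h
        simpa using hw
      · simpa [Function.update_of_ne h] using hvs j (Finset.mem_of_mem_insert_of_ne hj h)

variable [∀ i, SecondCountableTopology (X i)]
  [∀ i, MeasurableSpace (X i)] [∀ i, BorelSpace (X i)]

/-- Potentials can be improved and normalized to lie in a fixed compact set. -/
lemma exists_bounded_potentials [Nonempty ι] (ν : ∀ i, Measure (X i))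
    [∀ i, IsProbabilityMeasure (ν i)] (c : C(∀ i, X i, ℝ))
    (u : ∀ i, C(X i, ℝ)) (hu : ∀ x, ∑ i, u i (x i) ≤ c x) :
    ∃ v : ∀ i, C(X i, ℝ), ∑ i, ∫ y, u i y ∂(ν i) ≤ ∑ i, ∫ y, v i y ∂(ν i) ∧
      (∀ x, ∑ i, v i (x i) ≤ c x) ∧
      (∀ i x y, |v i x - v i y| ≤ dist (frozenCoordinate c i x) (frozenCoordinate c i y)) ∧
      ∀ i x, |v i x| ≤ (2 * Fintype.card ι + 1) * ‖c‖ := by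
  have hne : ∀ i, Nonempty (X i) := fun i => nonempty_of_isProbabilityMeasure (ν i)
  obtain ⟨i₀⟩ := ‹Nonempty ι›
  obtain ⟨a⟩ : Nonempty (∀ i, X i) := inferInstance
  obtain ⟨v, huv, hv, hmod⟩ := exists_equicontinuous_potentials c u hu Finset.univ
  set σ : ℝ := ∑ i, v i (a i)
  -- Vanishing at `a i` bounds every potential but the `i₀`-th by the oscillation `2 * ‖c‖`; index
  -- `i₀` absorbs the constants, so the sum is unchanged.
  let w : ∀ i, C(X i, ℝ) := fun i =>
    v i - ContinuousMap.const _ (v i (a i)) + ContinuousMap.const _ (if i = i₀ then σ else 0)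
  have hw_apply : ∀ i x, w i x = v i x - v i (a i) + if i = i₀ then σ else 0 := fun i x => rfl
  have hw : ∀ x, ∑ i, w i (x i) ≤ c x := by
    intro x
    have h := hv x
    simp only [hw_apply, Finset.sum_add_distrib, Finset.sum_sub_distrib, Finset.sum_ite_eq',
      Finset.mem_univ, if_true]
    linarith
  have hvw : ∑ i, ∫ y, v i y ∂(ν i) = ∑ i, ∫ y, w i y ∂(ν i) := by
    have h (i : ι) : ∫ y, w i y ∂(ν i) =
        ∫ y, v i y ∂(ν i) - v i (a i) + if i = i₀ then σ else 0 := by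
      simp only [hw_apply]
      have hi := integrable_of_continuous_compactSpace (ν i) (v i)
      have hi' : Integrable (fun y => v i y - v i (a i)) (ν i) := hi.sub (integrable_const _)
      rw [integral_add hi' (integrable_const _), integral_sub hi (integrable_const _)]
      simp
    simp only [h, Finset.sum_add_distrib, Finset.sum_sub_distrib, Finset.sum_ite_eq',
      Finset.mem_univ, if_true]
    simp [σ]
  -- Conjugating once more bounds the `i₀`-th potential below, by `-‖c‖` minus the bound on the
  -- others; the constraint bounds it above.
  obtain ⟨z, hwz, hz, hsum, hzlow⟩ := exists_conjugate_potential c w hw i₀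
  have hwbound : ∀ i ≠ i₀, ∀ x, |w i x| ≤ 2 * ‖c‖ := by
    intro i hi x
    rw [hw_apply, if_neg hi, add_zero]
    exact (hmod i (Finset.mem_univ i) x (a i)).trans (dist_frozenCoordinate_le c i _ _)
  have hc : ∀ x, |c x| ≤ ‖c‖ := fun x => c.norm_coe_le_norm x
  have hcard : (1 : ℝ) ≤ Fintype.card ι := by exact_mod_cast Fintype.card_pos_iff.2 ⟨i₀⟩
  have hn := norm_nonneg c
  have hcn : 1 * ‖c‖ ≤ Fintype.card ι * ‖c‖ := mul_le_mul_of_nonneg_right hcard hn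
  have herase : ∀ x : ∀ i, X i, |∑ j ∈ Finset.univ.erase i₀, w j (x j)| ≤
      Fintype.card ι * (2 * ‖c‖) := by
    intro x
    refine (Finset.abs_sum_le_sum_abs _ _).trans ?_
    refine (Finset.sum_le_card_nsmul _ _ (2 * ‖c‖)
      fun j hj => hwbound j (Finset.ne_of_mem_erase hj) _).trans ?_
    rw [nsmul_eq_mul]
    refine mul_le_mul_of_nonneg_right ?_ (by positivity)
    exact_mod_cast Finset.card_le_univ _
  refine ⟨Function.update w i₀ z, ?_, hsum, fun i => ?_, fun i x => ?_⟩
  · calc ∑ i, ∫ y, u i y ∂(ν i) ≤ ∑ i, ∫ y, v i y ∂(ν i) :=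
          Finset.sum_le_sum fun i _ => integral_mono (integrable_of_continuous_compactSpace _ _)
            (integrable_of_continuous_compactSpace _ _) (huv i)
      _ = ∑ i, ∫ y, w i y ∂(ν i) := hvw
      _ ≤ _ := by
        refine Finset.sum_le_sum fun i _ => integral_mono
          (integrable_of_continuous_compactSpace _ _)
            (integrable_of_continuous_compactSpace _ _) ?_
        by_cases h : i = i₀
        · subst h
          intro x
          simpa using hwz x
        · simp [Function.update_of_ne h]
  · by_cases h : i = i₀
    · subst h
      simpa using hz
    · simp only [Function.update_of_ne h]
      intro x y
      rw [hw_apply, hw_apply]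
      simpa using hmod i (Finset.mem_univ i) x y
  · by_cases h : i = i₀
    · subst h
      rw [Function.update_self, abs_le]
      constructor
      · refine hzlow _ (fun b x => ?_) x
        have h1 := (abs_le.1 (hc (Function.update b i x))).1
        have h2 := (abs_le.1 (herase b)).2
        linarith
      · have h1 := hsum (Function.update a i x)
        rw [sum_update_erase (fun j => Function.update w i z j)] at h1
        have h2 : ∑ j ∈ Finset.univ.erase i, Function.update w i z j (a j) =
            ∑ j ∈ Finset.univ.erase i, w j (a j) := by
          refine Finset.sum_congr rfl fun j hj => ?_
          rw [Function.update_of_ne (Finset.ne_of_mem_erase hj)]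
        rw [h2, Function.update_self] at h1
        have h3 := (abs_le.1 (herase a)).1
        have h4 := (abs_le.1 (hc (Function.update a i x))).2
        linarith
    · rw [Function.update_of_ne h]
      refine (hwbound i h x).trans ?_
      linarith

/-- **Kantorovich duality** for the multi-marginal problem on compact spaces, with attainment in
both problems. -/
theorem exists_plan_integral_eq [∀ i, T2Space (X i)] [Nonempty ι] (ν : ∀ i, Measure (X i))
    [∀ i, IsProbabilityMeasure (ν i)] (c : C(∀ i, X i, ℝ)) :
    ∃ γ : Measure (∀ i, X i), IsProbabilityMeasure γ ∧ (∀ i, γ.map (fun x => x i) = ν i) ∧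
      ∃ u : ∀ i, C(X i, ℝ), (∀ x, ∑ i, u i (x i) ≤ c x) ∧
        ∫ x, c x ∂γ = ∑ i, ∫ y, u i y ∂(ν i) := by
  obtain ⟨γ, hγ, hmarg, hdual⟩ := exists_plan_integral_lt ν c
  refine ⟨γ, hγ, hmarg, ?_⟩
  let A : Set (∀ i, C(X i, ℝ)) := (Set.pi univ fun i => {v : C(X i, ℝ) |
    (∀ x y, |v x - v y| ≤ dist (frozenCoordinate c i x) (frozenCoordinate c i y)) ∧
      ∀ x, |v x| ≤ (2 * Fintype.card ι + 1) * ‖c‖}) ∩ {u | ∀ x, ∑ i, u i (x i) ≤ c x}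
  have hA : IsCompact A := by
    refine (isCompact_univ_pi fun i => isCompact_setOf_modulus _
      (frozenCoordinate c i).continuous _).inter_right ?_
    simp only [Set.ofPred_forall]
    refine isClosed_iInter fun x => isClosed_le ?_ continuous_const
    refine continuous_finsetSum _ fun i _ => ?_
    exact (continuous_eval_const (x i)).comp (continuous_apply i)
  have himp : ∀ u : ∀ i, C(X i, ℝ), (∀ x, ∑ i, u i (x i) ≤ c x) → ∃ v ∈ A,
      ∑ i, ∫ y, u i y ∂(ν i) ≤ ∑ i, ∫ y, v i y ∂(ν i) := by
    intro u hu
    obtain ⟨v, h1, h2, h3, h4⟩ := exists_bounded_potentials ν c u hu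
    exact ⟨v, ⟨fun i _ => ⟨h3 i, h4 i⟩, h2⟩, h1⟩
  have hAne : A.Nonempty := by
    obtain ⟨u, hu, -⟩ := hdual 1 one_pos
    obtain ⟨v, hv, -⟩ := himp u hu
    exact ⟨v, hv⟩
  have hcont : Continuous fun u : ∀ i, C(X i, ℝ) => ∑ i, ∫ y, u i y ∂(ν i) := by
    refine continuous_finsetSum _ fun i _ => ?_
    have h : Continuous fun v : C(X i, ℝ) => ∫ y, v y ∂(ν i) := by
      refine LipschitzWith.continuous (K := 1) (LipschitzWith.of_dist_le_mul fun v w => ?_)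
      rw [NNReal.coe_one, one_mul, dist_eq_norm, ← integral_sub
        (integrable_of_continuous_compactSpace _ _) (integrable_of_continuous_compactSpace _ _)]
      refine (norm_integral_le_of_norm_le_const (C := dist v w)
        (Eventually.of_forall fun x => ?_)).trans ?_
      · rw [← dist_eq_norm]
        exact ContinuousMap.dist_apply_le_dist x
      · simp
    exact h.comp (continuous_apply i)
  obtain ⟨u, huA, hmax⟩ := hA.exists_isMaxOn hAne hcont.continuousOn
  refine ⟨u, huA.2, le_antisymm ?_ ?_⟩
  · refine le_of_forall_pos_le_add fun ε hε => ?_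
    obtain ⟨v, hv, hv'⟩ := hdual ε hε
    obtain ⟨w, hw, hw'⟩ := himp v hv
    have := hmax hw
    simp only [Set.mem_ofPred_eq] at this
    linarith
  · rw [← integral_piSum hmarg]
    exact integral_mono (integrable_of_continuous_compactSpace _ _)
      (integrable_of_continuous_compactSpace _ _) huA.2

end DualAttainment

/-! ### Differentiability and Lipschitz estimates for semi-concave costs. -/

section Semiconcave

/-- A concave function touched from below at an interior point by a differentiable function is
differentiable there, with the same derivative. -/
lemma ConcaveOn.hasFDerivAt_of_touching {E : Type*} [NormedAddCommGroup E] [NormedSpace ℝ E]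
    {f g : E → ℝ} {U : Set E} {x : E} {L : E →L[ℝ] ℝ} (hf : ConcaveOn ℝ U f) (hU : U ∈ 𝓝 x)
    (hgf : ∀ᶠ y in 𝓝 x, g y ≤ f y) (hx : g x = f x) (hg : HasFDerivAt g L x) :
    HasFDerivAt f L x := by
  rw [hasFDerivAt_iff_isLittleO_nhds_zero] at hg ⊢
  have hneg : Tendsto (fun h : E => -h) (𝓝 0) (𝓝 0) := by
    simpa using (continuous_neg (G := E)).tendsto 0
  have hadd : Tendsto (fun h : E => x + h) (𝓝 0) (𝓝 x) :=
    Continuous.tendsto' (by fun_prop) _ _ (by simp)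
  have h1 := hg.norm_left
  have h2 := (hg.comp_tendsto hneg).norm_left
  have h2' : (fun h : E => ‖g (x + -h) - g x - L (-h)‖) =o[𝓝 0] fun h => h :=
    h2.trans_isBigO (Asymptotics.isBigO_of_le _ fun h => by simp)
  -- Let `R` denote the first-order remainder at `x`. Touching and midpoint concavity give `R_g(h) ≤
  -- R_f(h) ≤ -R_g(-h)`.
  refine (Asymptotics.IsBigO.of_bound 1 ?_).trans_isLittleO (h1.add h2')
  have hev := hadd.eventually hgf
  have hevU : ∀ᶠ h in 𝓝 (0 : E), x + h ∈ U := hadd hU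
  filter_upwards [hev, hneg.eventually hev, hevU, hneg.eventually hevU] with h ha hb hc hd
  have hconc := hf.2 hc hd (by norm_num : (0 : ℝ) ≤ 1 / 2) (by norm_num : (0 : ℝ) ≤ 1 / 2)
    (by norm_num)
  have hmid : (1 / 2 : ℝ) • (x + h) + (1 / 2 : ℝ) • (x + -h) = x := by
    rw [← smul_add, show x + h + (x + -h) = (2 : ℝ) • x by rw [two_smul]; abel, smul_smul]
    norm_num
  rw [hmid] at hconc
  simp only [smul_eq_mul] at hconc
  have e1 := le_abs_self (g (x + -h) - g x - L (-h))
  have e2 := neg_abs_le (g (x + -h) - g x - L (-h))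
  have e3 := le_abs_self (g (x + h) - g x - L h)
  have e4 := neg_abs_le (g (x + h) - g x - L h)
  have e5 := abs_nonneg (g (x + -h) - g x - L (-h))
  have e6 := abs_nonneg (g (x + h) - g x - L h)
  rw [map_neg] at *
  rw [one_mul, Real.norm_eq_abs, Real.norm_eq_abs, Real.norm_eq_abs, Real.norm_eq_abs,
    abs_of_nonneg (by positivity : 0 ≤ |g (x + h) - g x - L h| + |g (x + -h) - g x - -(L h)|),
    abs_le]
  constructor <;> linarith

lemma hasMFDerivAt_real_iff {k : ℕ} {X : Type*} [TopologicalSpace X]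
    [ChartedSpace (EuclideanSpace ℝ (Fin k)) X] {f : X → ℝ} {p : X}
    {L : EuclideanSpace ℝ (Fin k) →L[ℝ] ℝ} :
    HasMFDerivAt (𝓡 k) 𝓘(ℝ, ℝ) f p L ↔ ContinuousAt f p ∧
      HasFDerivAt (fun v => f ((chartAt (EuclideanSpace ℝ (Fin k)) p).symm v)) L
        (chartAt (EuclideanSpace ℝ (Fin k)) p p) := by
  unfold HasMFDerivAt
  have h : writtenInExtChartAt (𝓡 k) 𝓘(ℝ, ℝ) p f =
      fun v => f ((chartAt (EuclideanSpace ℝ (Fin k)) p).symm v) := by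
    rfl
  rw [h, ModelWithCorners.range_eq_univ]
  exact and_congr Iff.rfl hasFDerivWithinAt_univ

/-- A function which is Lipschitz in local coordinates is differentiable almost everywhere. -/
lemma ae_mdifferentiableAt_of_lipschitz_in_charts {k : ℕ} {X : Type*} [TopologicalSpace X]
    [SecondCountableTopology X] [ChartedSpace (EuclideanSpace ℝ (Fin k)) X]
    [IsManifold (𝓡 k) ∞ X] [MeasurableSpace X] {μ : Measure X}
    (hμ : IsAbsolutelyContinuousInCharts k μ) {w : X → ℝ}
    (hw : ∀ q : X, ∃ V ∈ 𝓝 q, ∃ L : NNReal, ∀ y ∈ V, ∀ y' ∈ V, |w y - w y'| ≤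
      L * dist (chartAt (EuclideanSpace ℝ (Fin k)) q y) (chartAt (EuclideanSpace ℝ (Fin k)) q y')) :
    ∀ᵐ p ∂μ, MDifferentiableAt (𝓡 k) 𝓘(ℝ, ℝ) w p := by
  have : IsManifold (𝓡 k) 1 X := IsManifold.of_le (n := ∞) (by simp)
  have key : ∀ q : X, ∃ V ∈ 𝓝 q, μ (V ∩ {p | ¬ MDifferentiableAt (𝓡 k) 𝓘(ℝ, ℝ) w p}) = 0 := by
    intro q
    obtain ⟨V₀, hV₀, L, hL⟩ := hw q
    obtain ⟨V, hVsub, hVo, hqV⟩ := mem_nhds_iff.1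
      (inter_mem hV₀ ((chartAt (EuclideanSpace ℝ (Fin k)) q).open_source.mem_nhds
        (mem_chart_source _ q)))
    set φ := chartAt (EuclideanSpace ℝ (Fin k)) q with hφ
    have hVs : V ⊆ φ.source := fun y hy => (hVsub hy).2
    have hopen : IsOpen (φ '' V) := φ.isOpen_image_of_subset_source hVo hVs
    have hlip : LipschitzOnWith L (fun v => w (φ.symm v)) (φ '' V) := by
      refine LipschitzOnWith.of_dist_le_mul ?_
      rintro _ ⟨y, hy, rfl⟩ _ ⟨y', hy', rfl⟩
      rw [φ.left_inv (hVs hy), φ.left_inv (hVs hy')]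
      exact hL y (hVsub hy).1 y' (hVsub hy').1
    -- Rademacher in the chart at `q`; smooth compatibility of charts carries the conclusion to each
    -- nearby `y`.
    have hae := hlip.ae_differentiableWithinAt (μ := volume) hopen.measurableSet
    rw [ae_restrict_iff' hopen.measurableSet] at hae
    have hnull := hμ q _ (ae_iff.1 hae)
    refine ⟨V, hVo.mem_nhds hqV, measure_mono_null ?_ hnull⟩
    rintro y ⟨hy, hny⟩
    refine ⟨hVs hy, ?_⟩
    intro hdiff
    apply hny
    rw [mdifferentiableAt_iff_source_of_mem_source (x := q) (hVs hy)]
    have h := (hdiff (mem_image_of_mem _ hy)).differentiableAt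
      (hopen.mem_nhds (mem_image_of_mem _ hy))
    have h2 := h.mdifferentiableAt.mdifferentiableWithinAt (s := range (𝓡 k))
    simpa [mfld_simps, Function.comp_def, ← hφ] using h2
  choose V hV hVnull using key
  obtain ⟨s, hs, hcover⟩ := TopologicalSpace.countable_cover_nhds hV
  rw [ae_iff]
  refine measure_mono_null (t := ⋃ q ∈ s, V q ∩ _) ?_
    ((measure_biUnion_null_iff hs).2 fun q _ => hVnull q)
  intro p hp
  have hpc : p ∈ ⋃ q ∈ s, V q := hcover ▸ mem_univ p
  simp only [mem_iUnion] at hpc ⊢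
  obtain ⟨q, hq, hpq⟩ := hpc
  exact ⟨q, hq, hpq, hp⟩

variable {n : ℕ} {d : Fin (n + 1) → ℕ} {M : Fin (n + 1) → Type*} [∀ i, TopologicalSpace (M i)]
  [∀ i, ChartedSpace (EuclideanSpace ℝ (Fin (d i))) (M i)] {c : (∀ i, M i) → ℝ}

/-- If a semi-concave cost is touched from below by a function of the first variable which is
differentiable at the point of contact, it is differentiable in the first variable. -/
lemma IsSemiconcave.hasMFDerivAt_of_touching (hsc : IsSemiconcave (d := d) c) (hc : Continuous c)
    {w : M 0 → ℝ} {x : ∀ i, M i} {k : ℝ}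
    (hw : MDifferentiableAt (𝓡 (d 0)) 𝓘(ℝ, ℝ) w (x 0))
    (hle : ∀ y, w y + k ≤ c (Function.update x 0 y)) (heq : w (x 0) + k = c x) :
    HasMFDerivAt (𝓡 (d 0)) 𝓘(ℝ, ℝ) (fun y : M 0 => c (Function.update x 0 y)) (x 0)
      (mfderiv (𝓡 (d 0)) 𝓘(ℝ, ℝ) w (x 0)) := by
  obtain ⟨C, U, hU, -, hconc⟩ := hsc x
  have hw' := (hasMFDerivAt_real_iff.1 hw.hasMFDerivAt).2
  refine hasMFDerivAt_real_iff.2 ⟨by fun_prop, ?_⟩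
  set φ := fun i => chartAt (EuclideanSpace ℝ (Fin (d i))) (x i) with hφ
  set v₀ : ∀ i, EuclideanSpace ℝ (Fin (d i)) := fun i => φ i (x i) with hv₀
  have hupd : Continuous fun v : EuclideanSpace ℝ (Fin (d 0)) => Function.update v₀ 0 v := by
    fun_prop
  have hupd₀ : Function.update v₀ 0 (φ 0 (x 0)) = v₀ := Function.update_eq_self 0 v₀
  -- Freezing the other coordinates is an affine embedding, so concavity passes to the slice.
  have hcomb : ∀ (a b : ℝ) (v v' : EuclideanSpace ℝ (Fin (d 0))), a + b = 1 →
      Function.update v₀ 0 (a • v + b • v') =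
        a • Function.update v₀ 0 v + b • Function.update v₀ 0 v' := by
    intro a b v v' hab
    ext1 i
    by_cases h : i = 0
    · subst h
      simp
    · simp [Function.update_of_ne h, ← add_smul, hab]
  let Q : EuclideanSpace ℝ (Fin (d 0)) → ℝ := fun v => C * ∑ i, ‖Function.update v₀ 0 v i‖ ^ 2
  have hQ : Differentiable ℝ Q := by
    have h (i : Fin (n + 1)) : Differentiable ℝ
        fun v : EuclideanSpace ℝ (Fin (d 0)) => ‖Function.update v₀ 0 v i‖ ^ 2 := by
      by_cases h : i = 0
      · subst h
        simp only [Function.update_self]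
        exact differentiable_id.norm_sq ℝ
      · simp only [Function.update_of_ne h]
        exact differentiable_const _
    exact (Differentiable.fun_sum fun i _ => h i).const_mul C
  have hsymm : ∀ v, (fun i => (φ i).symm (Function.update v₀ 0 v i)) =
      Function.update x 0 ((φ 0).symm v) := by
    intro v
    ext1 i
    by_cases h : i = 0
    · subst h
      simp
    · simp only [Function.update_of_ne h]
      exact (φ i).left_inv (mem_chart_source _ (x i))
  have hconc' : ConcaveOn ℝ ((fun v => Function.update v₀ 0 v) ⁻¹' U)
      (fun v => c (Function.update x 0 ((φ 0).symm v)) - Q v) := by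
    refine ⟨fun v hv v' hv' a b ha hb hab => ?_, fun v hv v' hv' a b ha hb hab => ?_⟩
    · change Function.update v₀ 0 _ ∈ U
      rw [hcomb a b v v' hab]
      exact hconc.1 hv hv' ha hb hab
    · have h := hconc.2 hv hv' ha hb hab
      simp only [← hcomb a b v v' hab] at h
      simp only [← hsymm]
      exact h
  have hmain := hconc'.hasFDerivAt_of_touching (x := φ 0 (x 0))
    (g := fun v => w ((φ 0).symm v) + k - Q v) ?_
    (Eventually.of_forall fun v => sub_le_sub_right (hle _) _) ?_
    ((hw'.add_const k).sub (hQ _).hasFDerivAt)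
  · have h := hmain.add (hQ (φ 0 (x 0))).hasFDerivAt
    exact (h.congr_fderiv (sub_add_cancel _ _)).congr_of_eventuallyEq
      (Eventually.of_forall fun v => by simp [hφ])
  · refine hupd.continuousAt.preimage_mem_nhds ?_
    rwa [hupd₀]
  · have h : (φ 0).symm (φ 0 (x 0)) = x 0 := (φ 0).left_inv (mem_chart_source _ (x 0))
    simp only [h, heq, Function.update_eq_self]

/-- A semi-concave cost is locally Lipschitz in its first variable, locally uniformly in the
others. -/
lemma IsSemiconcave.exists_local_lipschitz (hsc : IsSemiconcave (d := d) c) (x : ∀ i, M i) :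
    ∃ V ∈ 𝓝 (x 0), ∃ N ∈ 𝓝 x, ∃ L : NNReal, ∀ z ∈ N, ∀ y ∈ V, ∀ y' ∈ V,
      |c (Function.update z 0 y) - c (Function.update z 0 y')| ≤
        L * dist (chartAt (EuclideanSpace ℝ (Fin (d 0))) (x 0) y)
          (chartAt (EuclideanSpace ℝ (Fin (d 0))) (x 0) y') := by
  obtain ⟨C, U, hU, -, hconc⟩ := hsc x
  set φ := fun i => chartAt (EuclideanSpace ℝ (Fin (d i))) (x i) with hφ
  set v₀ : ∀ i, EuclideanSpace ℝ (Fin (d i)) := fun i => φ i (x i) with hv₀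
  -- In finite dimension a concave function is locally Lipschitz in the interior, and the quadratic
  -- correction is `C¹`.
  obtain ⟨L₁, W₁, hW₁, hL₁⟩ := hconc.locallyLipschitzOn_interior (mem_interior_iff_mem_nhds.2 hU)
  rw [isOpen_interior.nhdsWithin_eq (mem_interior_iff_mem_nhds.2 hU)] at hW₁
  have hQ : ContDiff ℝ 1 fun v : ∀ i, EuclideanSpace ℝ (Fin (d i)) => C * ∑ i, ‖v i‖ ^ 2 :=
    contDiff_const.mul (ContDiff.sum fun i _ => ContDiff.norm_sq ℝ
      (ContinuousLinearMap.proj (R := ℝ)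
        (φ := fun i => EuclideanSpace ℝ (Fin (d i))) i).contDiff)
  obtain ⟨L₂, W₂, hW₂, hL₂⟩ := hQ.contDiffAt.exists_lipschitzOnWith (x := v₀)
  have hG : LipschitzOnWith (L₁ + L₂) (fun v : ∀ i, EuclideanSpace ℝ (Fin (d i)) =>
      c (fun i => (φ i).symm (v i))) (W₁ ∩ W₂) := by
    have h := (hL₁.mono inter_subset_left).add (hL₂.mono (inter_subset_right (s := W₁)))
    simpa using h
  have hΨ : ∀ᶠ p : (∀ i, M i) × M 0 in 𝓝 x ×ˢ 𝓝 (x 0),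
      (fun i => φ i (Function.update p.1 0 p.2 i)) ∈ W₁ ∩ W₂ ∧
        ∀ i, Function.update p.1 0 p.2 i ∈ (φ i).source := by
    have hcu : Continuous fun p : (∀ i, M i) × M 0 => Function.update p.1 0 p.2 := by fun_prop
    have htu : Tendsto (fun p : (∀ i, M i) × M 0 => Function.update p.1 0 p.2)
        (𝓝 x ×ˢ 𝓝 (x 0)) (𝓝 x) := by
      have := hcu.tendsto (x, x 0)
      simpa [nhds_prod_eq] using this
    have hφc : ContinuousAt (fun (z : ∀ i, M i) i => φ i (z i)) x :=
      continuousAt_pi.2 fun i => ((φ i).continuousAt (mem_chart_source _ (x i))).comp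
        (continuous_apply i).continuousAt
    refine ((hφc.tendsto.comp htu).eventually (inter_mem hW₁ hW₂)).and
      (eventually_all.2 fun i => ?_)
    have h1 : ∀ᶠ z : ∀ i, M i in 𝓝 x, z i ∈ (φ i).source :=
      (continuous_apply i).continuousAt.eventually
        ((φ i).open_source.mem_nhds (mem_chart_source _ (x i)))
    exact htu.eventually h1
  obtain ⟨N, hN, V, hV, hNV⟩ := eventually_prod_iff.1 hΨ
  refine ⟨{y | V y}, hV, {z | N z}, hN, L₁ + L₂, fun z hz y hy y' hy' => ?_⟩
  obtain ⟨h1, h1'⟩ := hNV hz hy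
  obtain ⟨h2, h2'⟩ := hNV hz hy'
  have h := hG.dist_le_mul _ h1 _ h2
  have e1 : (fun i => (φ i).symm (φ i (Function.update z 0 y i))) = Function.update z 0 y :=
    funext fun i => (φ i).left_inv (h1' i)
  have e2 : (fun i => (φ i).symm (φ i (Function.update z 0 y' i))) = Function.update z 0 y' :=
    funext fun i => (φ i).left_inv (h2' i)
  simp only [e1, e2] at h
  rw [Real.dist_eq] at h
  refine h.trans (mul_le_mul_of_nonneg_left ?_ (NNReal.coe_nonneg _))
  refine (dist_pi_le_iff dist_nonneg).2 fun i => ?_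
  by_cases hi : i = 0
  · subst hi
    simp [hφ]
  · simp [Function.update_of_ne hi]

/-- Finitely many local estimates cover `K`. Since `update` overwrites the first coordinate, it may
be taken to be `q`, so that only the chart at `q` occurs. -/
lemma IsSemiconcave.exists_uniform_lipschitz (hsc : IsSemiconcave (d := d) c) {K : Set (∀ i, M i)}
    (hK : IsCompact K) (q : M 0) :
    ∃ V ∈ 𝓝 q, ∃ L : NNReal, ∀ z ∈ K, ∀ y ∈ V, ∀ y' ∈ V,
      |c (Function.update z 0 y) - c (Function.update z 0 y')| ≤
        L * dist (chartAt (EuclideanSpace ℝ (Fin (d 0))) q y)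
          (chartAt (EuclideanSpace ℝ (Fin (d 0))) q y') := by
  have hloc : ∀ x : ∀ i, M i, x 0 = q → ∃ V ∈ 𝓝 q, ∃ N ∈ 𝓝 x, ∃ L : NNReal,
      ∀ z ∈ N, ∀ y ∈ V, ∀ y' ∈ V,
        |c (Function.update z 0 y) - c (Function.update z 0 y')| ≤
          L * dist (chartAt (EuclideanSpace ℝ (Fin (d 0))) q y)
            (chartAt (EuclideanSpace ℝ (Fin (d 0))) q y') := by
    rintro x rfl
    exact hsc.exists_local_lipschitz x
  refine hK.induction_on ⟨univ, univ_mem, 0, by simp⟩ ?_ ?_ ?_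
  · rintro s t hst ⟨V, hV, L, h⟩
    exact ⟨V, hV, L, fun z hz => h z (hst hz)⟩
  · rintro s t ⟨V, hV, L, h⟩ ⟨V', hV', L', h'⟩
    refine ⟨V ∩ V', inter_mem hV hV', max L L', ?_⟩
    rintro z (hz | hz) y hy y' hy'
    · exact (h z hz y hy.1 y' hy'.1).trans
        (mul_le_mul_of_nonneg_right (by exact_mod_cast le_max_left _ _) dist_nonneg)
    · exact (h' z hz y hy.2 y' hy'.2).trans
        (mul_le_mul_of_nonneg_right (by exact_mod_cast le_max_right _ _) dist_nonneg)
  · intro z _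
    obtain ⟨V, hV, N, hN, L, h⟩ := hloc (Function.update z 0 q) (Function.update_self ..)
    have hcu : Continuous fun z : ∀ i, M i => Function.update z 0 q := by fun_prop
    refine ⟨_, mem_nhdsWithin_of_mem_nhds (hcu.continuousAt.preimage_mem_nhds hN), V, hV, L,
      fun z' hz' y hy y' hy' => ?_⟩
    simpa using h _ hz' y hy y' hy'

end Semiconcave

/-! ### Borel extension of potentials from compact sets. -/

section Potentials

lemma Measurable.compactExhaustion_find {Y : Type*} [TopologicalSpace Y] [T2Space Y]
    [MeasurableSpace Y] [BorelSpace Y] (E : CompactExhaustion Y) : Measurable E.find := by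
  refine measurable_of_Iic fun k => ?_
  have h : E.find ⁻¹' Iic k = E k := by
    ext x
    exact E.mem_iff_find_le.symm
  rw [h]
  exact (E.isCompact k).measurableSet

/-- Potentials on compact subsets of the factors extend to Borel functions on the whole factors,
whose sum stays below a continuous cost. -/
lemma exists_measurable_extension_potentials {ι : Type*} [Fintype ι] {M : ι → Type*}
    [∀ i, TopologicalSpace (M i)] [∀ i, T2Space (M i)] [∀ i, SigmaCompactSpace (M i)]
    [∀ i, WeaklyLocallyCompactSpace (M i)] [∀ i, MeasurableSpace (M i)] [∀ i, BorelSpace (M i)]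
    {K : ∀ i, Set (M i)} (hK : ∀ i, IsCompact (K i)) {c : (∀ i, M i) → ℝ} (hc : Continuous c)
    (u : ∀ i, C(K i, ℝ)) (hu : ∀ z : ∀ i, K i, ∑ i, u i (z i) ≤ c fun i => z i) :
    ∃ v : ∀ i, M i → ℝ, (∀ i, Measurable (v i)) ∧ (∀ i (x : K i), v i x = u i x) ∧
      ∀ x, ∑ i, v i (x i) ≤ c x := by
  classical
  have hKc : ∀ i, CompactSpace (K i) := fun i => isCompact_iff_compactSpace.1 (hK i)
  let E : ∀ i, CompactExhaustion (M i) := fun i => CompactExhaustion.choice _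
  have hk : ∃ k, ∀ i, K i ⊆ E i k := by
    have h : ∀ i, ∃ k, K i ⊆ E i k := fun i => (E i).exists_superset_of_isCompact (hK i)
    choose k hk using h
    exact ⟨Finset.univ.sup k, fun i =>
      (hk i).trans ((E i).subset (Finset.le_sup (Finset.mem_univ i)))⟩
  obtain ⟨k₀, hk₀⟩ := hk
  have hb : ∀ k, ∃ b : ℝ, 0 ≤ b ∧ ∀ x : ∀ i, M i, (∀ i, x i ∈ E i k) → -b ≤ c x := by
    intro k
    obtain ⟨b, hb⟩ := ((isCompact_univ_pi fun i => (E i).isCompact k).image hc).bddBelow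
    refine ⟨max 0 (-b), le_max_left _ _, fun x hx => ?_⟩
    have h1 : b ≤ c x := hb (mem_image_of_mem _ fun i _ => hx i)
    linarith [le_max_right 0 (-b)]
  choose b hb0 hb using hb
  let A : ℝ := ∑ i, ‖u i‖
  have hA0 : 0 ≤ A := Finset.sum_nonneg fun i _ => norm_nonneg _
  have huA : ∀ i x, u i x ≤ A := fun i x => ((le_abs_self _).trans ((u i).norm_coe_le_norm x)).trans
    (Finset.single_le_sum (f := fun i => ‖u i‖) (fun i _ => norm_nonneg _) (Finset.mem_univ i))
  -- Off `K i` the potential drops below the lower bound of `c` at level `k + k₀` (hence `+ 1` in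
  -- the range), with `card ι * A` to offset the other potentials.
  let g : ℕ → ℝ := fun k => ∑ j ∈ Finset.range (k + k₀ + 1), b j + Fintype.card ι * A
  have hg0 : ∀ k, 0 ≤ g k := fun k =>
    add_nonneg (Finset.sum_nonneg fun j _ => hb0 j) (by positivity)
  let v : ∀ i, M i → ℝ := fun i =>
    Function.extend (Subtype.val : K i → M i) (u i) fun x => -g ((E i).find x)
  have hvK : ∀ i (x : K i), v i x = u i x := fun i x => Subtype.val_injective.extend_apply _ _ x
  have hvn : ∀ i x, x ∉ K i → v i x = -g ((E i).find x) := fun i x hx =>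
    Function.extend_apply' _ _ _ (by rintro ⟨y, rfl⟩; exact hx y.2)
  have hvA : ∀ i x, v i x ≤ A := by
    intro i x
    by_cases hx : x ∈ K i
    · exact (hvK i ⟨x, hx⟩).trans_le (huA i _)
    · rw [hvn i x hx]
      linarith [hg0 ((E i).find x)]
  refine ⟨v, fun i => ?_, hvK, fun x => ?_⟩
  · refine (MeasurableEmbedding.subtype_coe (hK i).measurableSet).measurable_extend
      (u i).continuous.measurable ?_
    exact ((measurable_from_nat (f := g)).comp (Measurable.compactExhaustion_find (E i))).neg
  · by_cases hx : ∀ i, x i ∈ K i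
    · calc ∑ i, v i (x i) = ∑ i, u i ⟨x i, hx i⟩ :=
            Finset.sum_congr rfl fun i _ => hvK i ⟨x i, hx i⟩
        _ ≤ c x := hu fun i => ⟨x i, hx i⟩
    · push Not at hx
      obtain ⟨i₁, hi₁⟩ := hx
      -- The coordinate farthest out decides: the whole point lies in its level raised by `k₀`, so
      -- its potential alone pays for `c` and all the others.
      obtain ⟨i, hi, hmax⟩ := Finset.exists_max_image (Finset.univ.filter fun i => x i ∉ K i)
        (fun i => (E i).find (x i)) ⟨i₁, by simpa using hi₁⟩
      have hxi : x i ∉ K i := (Finset.mem_filter.1 hi).2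
      have hmem : ∀ j, x j ∈ E j ((E i).find (x i) + k₀) := by
        intro j
        by_cases hj : x j ∈ K j
        · exact (E j).subset (Nat.le_add_left _ _) (hk₀ j hj)
        · refine (E j).subset ?_ ((E j).mem_find (x j))
          exact (hmax j (by simpa using hj)).trans (Nat.le_add_right _ _)
      have h1 := hb _ x hmem
      have h2 : b ((E i).find (x i) + k₀) ≤ ∑ j ∈ Finset.range ((E i).find (x i) + k₀ + 1), b j :=
        Finset.single_le_sum (f := b) (fun j _ => hb0 j) (by simp)
      rw [← Finset.add_sum_erase _ _ (Finset.mem_univ i), hvn i _ hxi]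
      have h3 : ∑ j ∈ Finset.univ.erase i, v j (x j) ≤ Fintype.card ι * A := by
        refine (Finset.sum_le_card_nsmul _ _ A fun j _ => hvA j _).trans ?_
        rw [nsmul_eq_mul]
        exact mul_le_mul_of_nonneg_right (by exact_mod_cast Finset.card_le_univ _) hA0
      simp only [g]
      linarith

end Potentials

/-! ### Measurable graphs from compact sets. -/

section Graph

/-- A plan concentrated on the graph of a map is the image of its first marginal. -/
lemma eq_map_cons_of_ae_graph {n : ℕ} {M : Fin (n + 1) → Type*} [∀ i, MeasurableSpace (M i)]
    {μ : ∀ i, Measure (M i)} {γ : Measure (∀ i, M i)} (hγ : IsTransportPlan μ γ)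
    {T : M 0 → ∀ j : Fin n, M j.succ} (hT : Measurable T)
    (h : ∀ᵐ x ∂γ, (fun j : Fin n => x j.succ) = T (x 0)) :
    γ = (μ 0).map (fun x => (Fin.cons x (T x) : ∀ i, M i)) := by
  have hcons : Measurable fun x => (Fin.cons x (T x) : ∀ i, M i) := by
    refine measurable_pi_iff.2 fun i => ?_
    refine Fin.cases ?_ (fun j => ?_) i
    · simpa using measurable_id'
    · simpa using measurable_pi_iff.1 hT j
  rw [← hγ.2 0, Measure.map_map hcons (measurable_pi_apply 0)]
  conv_lhs => rw [← Measure.map_id (μ := γ)]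
  refine Measure.map_congr ?_
  filter_upwards [h] with x hx
  simp only [Function.comp_apply, id, ← hx]
  exact (Fin.cons_self_tail x).symm

variable {n : ℕ} {M : Fin (n + 1) → Type*} [∀ i, TopologicalSpace (M i)] [∀ i, T2Space (M i)]
  [∀ i, SecondCountableTopology (M i)] [∀ i, MeasurableSpace (M i)] [∀ i, BorelSpace (M i)]

/-- A compact set with at most one point over each point of a Borel set `G` is there contained in
the graph of a Borel map. -/
lemma exists_measurable_graph {S : Set (∀ i, M i)} (hS : IsCompact S) {G : Set (M 0)}
    (hG : MeasurableSet G) (huniq : ∀ x ∈ S, ∀ y ∈ S, x 0 ∈ G → x 0 = y 0 → x = y)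
    [Nonempty (∀ j : Fin n, M j.succ)] :
    ∃ T : M 0 → ∀ j : Fin n, M j.succ, Measurable T ∧
      ∀ x ∈ S, x 0 ∈ G → (fun j : Fin n => x j.succ) = T (x 0) := by
  classical
  obtain ⟨t₀⟩ := ‹Nonempty (∀ j : Fin n, M j.succ)›
  have hp0 : Continuous fun x : ∀ i, M i => x 0 := continuous_apply 0
  have htail : Continuous fun (x : ∀ i, M i) (j : Fin n) => x j.succ := by fun_prop
  let D : Set (M 0) := G ∩ (fun x : ∀ i, M i => x 0) '' S
  have hD : MeasurableSet D := hG.inter (hS.image hp0).measurableSet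
  have hDex : ∀ p : M 0, ∃ t : ∀ j : Fin n, M j.succ,
      (p ∈ D → ∃ x ∈ S, x 0 = p ∧ (fun j : Fin n => x j.succ) = t) ∧ (p ∉ D → t = t₀) := by
    intro p
    by_cases hp : p ∈ D
    · obtain ⟨x, hx, hxp⟩ := hp.2
      exact ⟨_, fun _ => ⟨x, hx, hxp, rfl⟩, fun h => absurd hp h⟩
    · exact ⟨t₀, fun h => absurd h hp, fun _ => rfl⟩
  choose T hT hT' using hDex
  have hgraph : ∀ x ∈ S, x 0 ∈ G → (fun j : Fin n => x j.succ) = T (x 0) := by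
    intro x hx hxG
    obtain ⟨y, hy, hyx, hyT⟩ := hT (x 0) ⟨hxG, mem_image_of_mem _ hx⟩
    rw [← hyT, huniq x hx y hy hxG hyx.symm]
  refine ⟨T, measurable_of_isClosed fun F hF => ?_, hgraph⟩
  -- Over `D` the preimage of a closed set is a projection of a compact part of `S`; off `D` the map
  -- is constant. No measurable selection theorem is needed.
  have hpre : T ⁻¹' F = (D ∩ (fun x : ∀ i, M i => x 0) ''
      (S ∩ (fun (x : ∀ i, M i) (j : Fin n) => x j.succ) ⁻¹' F)) ∪ (Dᶜ ∩ {_p | t₀ ∈ F}) := by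
    ext p
    by_cases hp : p ∈ D
    · simp only [mem_preimage, mem_union, mem_inter_iff, hp, true_and, mem_compl_iff, not_true,
        false_and, or_false, mem_image]
      constructor
      · intro h
        obtain ⟨x, hx, hxp, hxT⟩ := hT p hp
        exact ⟨x, ⟨hx, by rwa [hxT]⟩, hxp⟩
      · rintro ⟨x, ⟨hx, hxF⟩, rfl⟩
        rwa [← hgraph x hx hp.1]
    · simp [hp, hT' p hp]
  rw [hpre]
  exact (hD.inter ((hS.inter_right (hF.preimage htail)).image hp0).measurableSet).union
    (hD.compl.inter (MeasurableSet.const _))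

end Graph

/-! ### Duality for compactly supported marginals. -/

section Plans

variable {n : ℕ} {M : Fin (n + 1) → Type*} [∀ i, MeasurableSpace (M i)]
  {μ : ∀ i, Measure (M i)}

lemma IsTransportPlan.ae_mem {γ : Measure (∀ i, M i)} (hγ : IsTransportPlan μ γ)
    {K : ∀ i, Set (M i)} (hK : ∀ i, ∀ᵐ y ∂(μ i), y ∈ K i) : ∀ᵐ x ∂γ, ∀ i, x i ∈ K i := by
  refine ae_all_iff.2 fun i => ?_
  have h := hK i
  rw [← hγ.2 i] at h
  exact ae_of_ae_map (measurable_pi_apply i).aemeasurable h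

lemma IsTransportPlan.integrable_sum {γ : Measure (∀ i, M i)} (hγ : IsTransportPlan μ γ)
    {v : ∀ i, M i → ℝ} (hv : ∀ i, Integrable (v i) (μ i)) :
    Integrable (fun x => ∑ i, v i (x i)) γ ∧
      ∫ x, ∑ i, v i (x i) ∂γ = ∑ i, ∫ y, v i y ∂(μ i) := by
  have h : ∀ i, Integrable (fun x : ∀ i, M i => v i (x i)) γ := by
    intro i
    have := hv i
    rw [← hγ.2 i] at this
    exact this.comp_measurable (measurable_pi_apply i)
  refine ⟨integrable_finsetSum _ fun i _ => h i, ?_⟩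
  rw [integral_finsetSum _ fun i _ => h i]
  refine Finset.sum_congr rfl fun i _ => ?_
  have hi := (hv i).aestronglyMeasurable
  rw [← hγ.2 i] at hi ⊢
  rw [integral_map (measurable_pi_apply i).aemeasurable hi]

variable [∀ i, TopologicalSpace (M i)] [∀ i, SecondCountableTopology (M i)]
  [∀ i, BorelSpace (M i)]

lemma IsTransportPlan.integrable_cost {γ : Measure (∀ i, M i)} (hγ : IsTransportPlan μ γ)
    {K : ∀ i, Set (M i)} (hKc : ∀ i, IsCompact (K i)) (hK : ∀ i, ∀ᵐ y ∂(μ i), y ∈ K i)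
    {c : (∀ i, M i) → ℝ} (hc : Continuous c) : Integrable c γ := by
  have := hγ.1
  obtain ⟨B, hB⟩ := (isCompact_univ_pi hKc).exists_bound_of_continuousOn hc.continuousOn
  refine Integrable.of_bound hc.aestronglyMeasurable B ?_
  filter_upwards [hγ.ae_mem hK] with x hx
  exact hB x fun i _ => hx i

variable [∀ i, T2Space (M i)] [∀ i, IsProbabilityMeasure (μ i)]

/-- **Kantorovich duality** for compactly supported marginals: an optimal plan exists, and all
optimal plans are concentrated on the contact set of one family of continuous potentials on the
supports of the marginals. -/
theorem exists_optimalPlan_potentials [∀ i, SigmaCompactSpace (M i)]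
    [∀ i, WeaklyLocallyCompactSpace (M i)] (hμ : ∀ i, IsCompact (μ i).support)
    {c : (∀ i, M i) → ℝ} (hc : Continuous c) :
    (∃ γ, IsOptimalPlan c μ γ) ∧
      ∃ (u : ∀ i, C((μ i).support, ℝ)) (v : ∀ i, M i → ℝ), (∀ i, Measurable (v i)) ∧
        (∀ i (y : (μ i).support), v i y = u i y) ∧ (∀ x, ∑ i, v i (x i) ≤ c x) ∧
        ∀ γ, IsOptimalPlan c μ γ → ∀ᵐ x ∂γ, ∃ z : ∀ i, (μ i).support,
          (fun i => (z i : M i)) = x ∧ ∑ i, u i (z i) = c x := by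
  have hcomp : ∀ i, CompactSpace (μ i).support := fun i => isCompact_iff_compactSpace.1 (hμ i)
  have hmeas : ∀ i, MeasurableSet (μ i).support := fun i => (hμ i).measurableSet
  have hsupp : ∀ i, ∀ᵐ y ∂(μ i), y ∈ (μ i).support := fun i => Measure.support_mem_ae
  -- The marginals become probability measures on compact spaces, where duality with attainment
  -- applies.
  let ν : ∀ i, Measure (μ i).support := fun i => (μ i).comap Subtype.val
  have hνmap : ∀ i, (ν i).map Subtype.val = μ i := by
    intro i
    rw [map_comap_subtype_coe (hmeas i), Measure.restrict_eq_self_of_ae_mem (hsupp i)]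
  have hν : ∀ i, IsProbabilityMeasure (ν i) := by
    intro i
    refine (Measure.isProbabilityMeasure_map_iff measurable_subtype_coe.aemeasurable).1 ?_
    rw [hνmap]
    infer_instance
  have hcoe : Continuous fun (z : ∀ i, (μ i).support) i => (z i : M i) := by fun_prop
  have hcoem : Measurable fun (z : ∀ i, (μ i).support) i => (z i : M i) := hcoe.measurable
  obtain ⟨γ₀, hγ₀, hmarg, u, hu, heq⟩ := exists_plan_integral_eq ν ⟨_, hc.comp hcoe⟩
  obtain ⟨v, hvm, hvu, hvc⟩ := exists_measurable_extension_potentials hμ hc u hu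
  have hvint : ∀ i, Integrable (v i) (μ i) := by
    intro i
    refine Integrable.of_bound (hvm i).aestronglyMeasurable ‖u i‖ ?_
    filter_upwards [hsupp i] with y hy
    rw [hvu i ⟨y, hy⟩]
    exact (u i).norm_coe_le_norm _
  have hsum : ∑ i, ∫ y, u i y ∂(ν i) = ∑ i, ∫ y, v i y ∂(μ i) := by
    refine Finset.sum_congr rfl fun i _ => ?_
    have h := integral_map (μ := ν i) measurable_subtype_coe.aemeasurable
      (hvm i).aestronglyMeasurable
    rw [hνmap i] at h
    simp only [h, hvu]
  have hplan : IsTransportPlan μ (γ₀.map fun z i => (z i : M i)) := by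
    refine ⟨Measure.isProbabilityMeasure_map hcoem.aemeasurable, fun i => ?_⟩
    rw [Measure.map_map (measurable_pi_apply i) hcoem, ← hνmap i, ← hmarg i,
      Measure.map_map measurable_subtype_coe (measurable_pi_apply i)]
    rfl
  have hcost : ∫ x, c x ∂(γ₀.map fun z i => (z i : M i)) = ∑ i, ∫ y, v i y ∂(μ i) := by
    rw [integral_map hcoem.aemeasurable hc.aestronglyMeasurable, ← hsum, ← heq]
    rfl
  refine ⟨⟨_, hplan, fun γ' hγ' => ?_⟩, u, v, hvm, hvu, hvc, fun γ' hγ' => ?_⟩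
  · rw [hcost, ← (hγ'.integrable_sum hvint).2]
    exact integral_mono (hγ'.integrable_sum hvint).1 (hγ'.integrable_cost hμ hsupp hc) hvc
  · have h1 := hγ'.1.integrable_sum hvint
    have h2 := hγ'.1.integrable_cost hμ hsupp hc
    have h3 := hγ'.2 _ hplan
    rw [hcost, ← h1.2] at h3
    -- Optimality gives `γ'` at most the dual value as cost, so the nonnegative gap integrates to
    -- zero.
    have h4 : ∫ x, (c x - ∑ i, v i (x i)) ∂γ' = 0 := by
      refine le_antisymm ?_ (integral_nonneg fun x => sub_nonneg.2 (hvc x))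
      rw [integral_sub h2 h1.1]
      linarith
    rw [integral_eq_zero_iff_of_nonneg (fun x => sub_nonneg.2 (hvc x)) (h2.sub h1.1)] at h4
    filter_upwards [h4, hγ'.1.ae_mem hsupp] with x hx hxs
    refine ⟨fun i => ⟨x i, hxs i⟩, rfl, ?_⟩
    simp only [Pi.zero_apply] at hx
    simp only [← hvu]
    linarith

end Plans

/-! ### The Monge property and uniqueness. -/

theorem theorem3p1 {n : ℕ} {d : Fin (n + 1) → ℕ} {M : Fin (n + 1) → Type*}
    [∀ i, TopologicalSpace (M i)] [∀ i, T2Space (M i)] [∀ i, SecondCountableTopology (M i)]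
    [∀ i, ChartedSpace (EuclideanSpace ℝ (Fin (d i))) (M i)]
    [∀ i, IsManifold (𝓡 (d i)) ∞ (M i)]
    [∀ i, MeasurableSpace (M i)] [∀ i, BorelSpace (M i)]
    (μ : ∀ i, Measure (M i)) [∀ i, IsProbabilityMeasure (μ i)]
    (hμ : ∀ i, IsCompact (μ i).support)
    (c : (∀ i, M i) → ℝ) (hc : Continuous c) (hsc : IsSemiconcave (d := d) c)
    (htwist : IsTwistedOnSplittingSets (d := d) c)
    (hac : IsAbsolutelyContinuousInCharts (d 0) (μ 0)) :
    (∀ γ, IsOptimalPlan c μ γ → InducesMongeSolution μ γ) ∧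
      ∃! γ, IsOptimalPlan c μ γ := by
  have hlc : ∀ i, LocallyCompactSpace (M i) := fun i =>
    ChartedSpace.locallyCompactSpace (EuclideanSpace ℝ (Fin (d i))) (M i)
  obtain ⟨⟨γ, hγ⟩, u, v, hvm, hvu, hvc, hconc⟩ := exists_optimalPlan_potentials hμ hc
  have hcomp : ∀ i, CompactSpace (μ i).support := fun i => isCompact_iff_compactSpace.1 (hμ i)
  have hnes : ∀ i, Nonempty (μ i).support := fun i =>
    (Measure.nonempty_support (IsProbabilityMeasure.ne_zero (μ i))).to_subtype
  have hnet : Nonempty (∀ j : Fin n, M j.succ) := ⟨fun j => (hnes j.succ).some.1⟩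
  let ζ : (∀ i, (μ i).support) → ∀ i, M i := fun z i => z i
  have hζ : Continuous ζ := by fun_prop
  let r : (∀ i, (μ i).support) → ℝ := fun z => ∑ j ∈ Finset.univ.erase 0, u j (z j)
  have hr : Continuous r := by fun_prop
  -- The conjugate is taken over the supports only, for uniform Lipschitz bounds, but defined on all
  -- of `M 0`, so that it can be differentiated. It equals `u 0` at contact points.
  let w : M 0 → ℝ := fun y => ⨅ z, (c (Function.update (ζ z) 0 y) - r z)
  have hbdd : ∀ y, BddBelow (range fun z => c (Function.update (ζ z) 0 y) - r z) := fun y =>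
    (isCompact_range (by fun_prop)).bddBelow
  have hwle : ∀ y z, w y + r z ≤ c (Function.update (ζ z) 0 y) := by
    intro y z
    have : w y ≤ _ := ciInf_le (hbdd y) z
    linarith
  have hwlip : ∀ q : M 0, ∃ V ∈ 𝓝 q, ∃ L : NNReal, ∀ y ∈ V, ∀ y' ∈ V, |w y - w y'| ≤
      L * dist (chartAt (EuclideanSpace ℝ (Fin (d 0))) q y)
        (chartAt (EuclideanSpace ℝ (Fin (d 0))) q y') := by
    intro q
    obtain ⟨V, hV, L, hL⟩ := hsc.exists_uniform_lipschitz (isCompact_range hζ) q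
    have hone : ∀ y ∈ V, ∀ y' ∈ V, w y - w y' ≤
        L * dist (chartAt (EuclideanSpace ℝ (Fin (d 0))) q y)
          (chartAt (EuclideanSpace ℝ (Fin (d 0))) q y') := by
      intro y hy y' hy'
      rw [sub_le_iff_le_add', ← sub_le_iff_le_add]
      refine le_ciInf fun z => ?_
      have h1 := hwle y z
      have h2 := (abs_le.1 (hL _ (mem_range_self z) y hy y' hy')).2
      linarith
    refine ⟨V, hV, L, fun y hy y' hy' => abs_sub_le_iff.2 ⟨hone y hy y' hy', ?_⟩⟩
    rw [dist_comm]
    exact hone y' hy' y hy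
  have hwdiff := ae_mdifferentiableAt_of_lipschitz_in_charts hac hwlip
  let S : Set (∀ i, M i) := ζ '' {z | ∑ i, u i (z i) = c (ζ z)}
  have hS : IsCompact S := by
    refine (IsClosed.isCompact (isClosed_eq ?_ (hc.comp hζ))).image hζ
    fun_prop
  have hder : ∀ x ∈ S, MDifferentiableAt (𝓡 (d 0)) 𝓘(ℝ, ℝ) w (x 0) →
      HasMFDerivAt (𝓡 (d 0)) 𝓘(ℝ, ℝ) (fun y : M 0 => c (Function.update x 0 y)) (x 0)
        (mfderiv (𝓡 (d 0)) 𝓘(ℝ, ℝ) w (x 0)) := by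
    rintro _ ⟨z, hz, rfl⟩ hdiff
    have hz' : u 0 (z 0) + r z = c (ζ z) := by
      rw [← hz]
      exact Finset.add_sum_erase _ (fun i => u i (z i)) (Finset.mem_univ 0)
    -- Contact: `z` itself competes in the infimum, and the constraint on the potentials makes `w`
    -- at least `u 0` on the support.
    refine hsc.hasMFDerivAt_of_touching hc (k := r z) hdiff (fun y => hwle y z) (le_antisymm ?_ ?_)
    · have := hwle (ζ z 0) z
      rwa [Function.update_eq_self] at this
    · rw [← hz']
      refine add_le_add_left (le_ciInf fun z' => ?_) _
      have h1 := hvc (Function.update (ζ z') 0 (ζ z 0))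
      rw [sum_update_erase] at h1
      have h2 : ∑ j ∈ Finset.univ.erase 0, v j (ζ z' j) = r z' :=
        Finset.sum_congr rfl fun j _ => hvu j (z' j)
      have h3 : v 0 (ζ z 0) = u 0 (z 0) := hvu 0 (z 0)
      linarith
  -- The measurable hull supplies a Borel set of full measure without proving the differentiability
  -- set Borel.
  let G : Set (M 0) := (toMeasurable (μ 0) {p | ¬ MDifferentiableAt (𝓡 (d 0)) 𝓘(ℝ, ℝ) w p})ᶜ
  have hG : MeasurableSet G := (measurableSet_toMeasurable _ _).compl
  have hGdiff : ∀ p ∈ G, MDifferentiableAt (𝓡 (d 0)) 𝓘(ℝ, ℝ) w p := by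
    intro p hp
    by_contra h
    exact hp (subset_toMeasurable _ _ h)
  have hGae : ∀ᵐ p ∂(μ 0), p ∈ G := by
    rw [ae_iff]
    simp only [G, mem_compl_iff, not_not, Set.ofPred_mem_eq]
    rw [measure_toMeasurable]
    exact ae_iff.1 hwdiff
  have huniq : ∀ x ∈ S, ∀ y ∈ S, x 0 ∈ G → x 0 = y 0 → x = y := by
    intro x hx y hy hxG hxy
    -- Splitting requires Borel functions on the whole factors, hence the extensions `v`.
    have hsplit : IsSplittingSet c {a ∈ S | a 0 = x 0} := by
      refine ⟨v, hvm, hvc, ?_⟩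
      rintro _ ⟨⟨z, hz, rfl⟩, -⟩
      rw [← hz]
      exact Finset.sum_congr rfl fun i _ => hvu i (z i)
    have hd : ∀ a ∈ S, a 0 = x 0 →
        HasMFDerivAt (𝓡 (d 0)) 𝓘(ℝ, ℝ) (fun b : M 0 => c (Function.update a 0 b)) (x 0)
          (mfderiv (𝓡 (d 0)) 𝓘(ℝ, ℝ) w (x 0)) := by
      intro a ha hax
      have h := hder a ha
      rw [hax] at h
      exact h (hGdiff _ hxG)
    refine htwist (x 0) _ (fun a ha => ha.2) hsplit
      ⟨⟨hx, rfl⟩, (hd x hx rfl).mdifferentiableAt⟩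
      ⟨⟨hy, hxy.symm⟩, (hd y hy hxy.symm).mdifferentiableAt⟩ ?_
    exact (hd x hx rfl).mfderiv.trans (hd y hy hxy.symm).mfderiv.symm
  obtain ⟨T, hT, hTS⟩ := exists_measurable_graph hS hG huniq
  have hgraph : ∀ γ, IsOptimalPlan c μ γ →
      ∀ᵐ x ∂γ, (fun j : Fin n => x j.succ) = T (x 0) := by
    intro γ hγ
    have hG' : ∀ᵐ x ∂γ, x 0 ∈ G := by
      have h := hGae
      rw [← hγ.1.2 0] at h
      exact ae_of_ae_map (measurable_pi_apply 0).aemeasurable h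
    filter_upwards [hconc γ hγ, hG'] with x hx hxG
    obtain ⟨z, rfl, hz⟩ := hx
    exact hTS _ ⟨z, hz, rfl⟩ hxG
  have hmap := fun γ (hγ : IsOptimalPlan c μ γ) => eq_map_cons_of_ae_graph hγ.1 hT (hgraph γ hγ)
  exact ⟨fun γ hγ => ⟨T, hT, hgraph γ hγ, hmap γ hγ⟩,
    γ, hγ, fun γ' hγ' => (hmap γ' hγ').trans (hmap γ hγ).symm⟩
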